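/- Let $\lambda>0$ be a fixed real number. For real $X$ and $K$ let $$\mathcal{B}_X(K)=\{m\in[1,X]\cap\mathbb{Z} : \text{there exists a prime in } (m,m+K]\}.$$ Then there exist a constant $c=c(\lambda)>0$ and a number $X_0=X_0(\lambda)$ such that for every real $X\ge X_0$ $$|\mathcal{B}_X(\lambda\log X)|\ \ge\ c\,X .$$ -/

import Mathlib

/-- The set `𝓑(K)` relative to the parameter `X`: the integers `m` with `1 ≤ m ≤ X` such that
the half-open interval `(m, m + K]` contains a prime number. -/
def primeIntervalStarts (X K : ℝ) : Set ℕ :=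
  {m : ℕ | 1 ≤ m ∧ (m : ℝ) ≤ X ∧ ∃ p : ℕ, p.Prime ∧ (p : ℝ) ∈ Set.Ioc (m : ℝ) ((m : ℝ) + K)}

/-- The set is finite, so its `ncard` is its genuine cardinality. -/
theorem primeIntervalStarts_finite (X K : ℝ) : (primeIntervalStarts X K).Finite :=
  (Set.finite_Iic ⌊X⌋₊).subset fun _ hm => Nat.le_floor hm.2.1

/-!
The proof is by the second moment method. Let `k = ⌊lam * log X⌋`, let `P` be the set of primes in
`(k, X]`, and let `r m` be the number of elements of `P` in `(m, m + k]`. Then `∑ r m = k * |P|`,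
and the Cauchy–Schwarz inequality (`card_sq_mul_le`) bounds the number of `m` with `r m ≠ 0` from
below by `(∑ r m) ^ 2 / ∑ r m ^ 2`. The second moment is at most `2 * k` times the number of pairs
of elements of `P` with difference `0 ≤ h < k`. With Chebyshev's bound `|P| ≫ X / log X`, all that is
needed is that there are `O(k * X / log ^ 2 X)` such pairs with `h ≠ 0`
(`sum_primePairCount_le`).

For fixed `h` the pairs are counted by Selberg's sieve. For a prime `p` with `r` removed residues
let `ψ_p` be `-1` on the removed residues and `r / (p - r)` on the others; it has mean `0` and mean
square `r / (p - r)`. By the Chinese remainder theorem the products `ψ_d = ∏ p ∣ d, ψ_p`, for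
squarefree `d ≤ R`, are orthogonal over full periods, so `F = ∑ d ≤ R, ψ_d` has mean square
`G = ∑ d ≤ R, ∏ p ∣ d, r / (p - r)`, up to a small error. As `F = G` on the sifted set, this set has
density at most about `1 / G` (`card_sifted_mul_le`).

The lower bound `log ^ 2 y ≤ 8 * (σ(q) / q) * G` for `R = y ^ 2` and `q = 2 * h`
(`log_sq_le_selbergSum`) is elementary: `G` is at least the sum of `1 / (a * b)` over coprime pairs
of squarefree `a, b ≤ y` with `a` coprime to `q`, and each of the conditions can be dropped at the
cost of a bounded factor or of `σ(q) / q`. The singular series is thus replaced by `σ(q) / q`, which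
is bounded on average (`sum_sumInvDivisors_le`).
-/

/-! ### Sums of periodic functions -/

theorem sum_range_mul_of_periodic {f : ℕ → ℝ} {M : ℕ} (hf : Function.Periodic f M) (q : ℕ) :
    ∑ n ∈ Finset.range (M * q), f n = q * ∑ n ∈ Finset.range M, f n := by
  induction q with
  | zero => simp
  | succ q ih =>
    rw [Nat.mul_succ, Finset.sum_range_add, ih]
    have : ∀ n, f (M * q + n) = f n := fun n => by
      have := hf.nat_mul q n
      rw [← this]; congr 1; push_cast; ring
    simp only [this]
    push_cast; ring

/-- A periodic function with nonnegative sum over a period has partial sums at most its mean value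
times the length, up to one incomplete period. -/
theorem sum_range_le_of_periodic {f : ℕ → ℝ} {M : ℕ} {m B : ℝ} (hM : 0 < M)
    (hf : Function.Periodic f M) (hB : ∀ n, |f n| ≤ B) (hm : 0 ≤ m)
    (hS : ∑ n ∈ Finset.range M, f n = M * m) (N : ℕ) :
    ∑ n ∈ Finset.range N, f n ≤ N * m + M * B := by
  have hB0 : 0 ≤ B := (abs_nonneg _).trans (hB 0)
  conv_lhs => rw [← Nat.div_add_mod N M]
  rw [Finset.sum_range_add, sum_range_mul_of_periodic hf, hS]
  refine add_le_add ?_ ?_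
  · rw [← mul_assoc]
    gcongr
    exact_mod_cast Nat.div_mul_le_self N M
  · calc ∑ n ∈ Finset.range (N % M), f (M * (N / M) + n)
        ≤ ∑ n ∈ Finset.range (N % M), B :=
          Finset.sum_le_sum fun n _ => (le_abs_self _).trans (hB _)
      _ = (N % M : ℕ) * B := by simp
      _ ≤ M * B := by
        gcongr
        exact (Nat.mod_lt N hM).le

theorem sum_range_mul_of_coprime {f g : ℕ → ℝ} {a b : ℕ} (ha : 0 < a) (hb : 0 < b)
    (hab : a.Coprime b) (hf : Function.Periodic f a) (hg : Function.Periodic g b) :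
    ∑ n ∈ Finset.range (a * b), f n * g n =
      (∑ n ∈ Finset.range a, f n) * ∑ n ∈ Finset.range b, g n := by
  rw [Finset.sum_mul_sum, ← Finset.sum_product']
  refine Finset.sum_bij' (fun n _ => (n % a, n % b))
    (fun x _ => (Nat.chineseRemainder hab x.1 x.2 : ℕ)) ?_ ?_ ?_ ?_ ?_
  · intro n _
    simp [Nat.mod_lt _ ha, Nat.mod_lt _ hb]
  · rintro ⟨x, y⟩ _
    simpa using Nat.chineseRemainder_lt_mul hab x y ha.ne' hb.ne'
  · intro n hn
    rw [Finset.mem_range] at hn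
    have h := Nat.chineseRemainder_modEq_unique hab (a := n % a) (b := n % b) (z := n)
      (Nat.mod_modEq n a).symm (Nat.mod_modEq n b).symm
    have h1 := Nat.chineseRemainder_lt_mul hab (n % a) (n % b) ha.ne' hb.ne'
    exact (Nat.ModEq.eq_of_lt_of_lt h hn h1).symm
  · rintro ⟨x, y⟩ hxy
    simp only [Finset.mem_product, Finset.mem_range] at hxy
    have h := (Nat.chineseRemainder hab x y).2
    ext
    · exact Eq.trans h.1 (Nat.mod_eq_of_lt hxy.1)
    · exact Eq.trans h.2 (Nat.mod_eq_of_lt hxy.2)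
  · intro n _
    rw [hf.map_mod_nat, hg.map_mod_nat]

theorem periodic_prod {S : Finset ℕ} {f : ℕ → ℕ → ℝ}
    (hf : ∀ p ∈ S, Function.Periodic (f p) p) :
    Function.Periodic (fun n => ∏ p ∈ S, f p n) (∏ p ∈ S, p) := by
  intro n
  refine Finset.prod_congr rfl fun p hp => ?_
  obtain ⟨c, hc⟩ := Finset.dvd_prod_of_mem (fun p : ℕ => p) hp
  have := (hf p hp).nat_mul c n
  rw [hc, mul_comm, ← this]
  simp

theorem sum_range_prod_of_periodic {S : Finset ℕ} (hS : ∀ p ∈ S, p.Prime) {f : ℕ → ℕ → ℝ}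
    (hf : ∀ p ∈ S, Function.Periodic (f p) p) :
    ∑ n ∈ Finset.range (∏ p ∈ S, p), ∏ p ∈ S, f p n =
      ∏ p ∈ S, ∑ n ∈ Finset.range p, f p n := by
  induction S using Finset.induction_on with
  | empty => simp
  | insert a s ha ih =>
    have hS' : ∀ p ∈ s, p.Prime := fun p hp => hS p (Finset.mem_insert_of_mem hp)
    have hf' : ∀ p ∈ s, Function.Periodic (f p) p :=
      fun p hp => hf p (Finset.mem_insert_of_mem hp)
    have hap : a.Prime := hS a (Finset.mem_insert_self _ _)
    simp only [Finset.prod_insert ha]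
    rw [sum_range_mul_of_coprime hap.pos (Finset.prod_pos fun p hp => (hS' p hp).pos) ?_
      (hf a (Finset.mem_insert_self _ _)) (periodic_prod hf'), ih hS' hf']
    refine Nat.Coprime.prod_right fun p hp => ?_
    rw [Nat.coprime_primes hap (hS' p hp)]
    rintro rfl
    exact ha hp

/-! ### A sieve by orthogonal functions -/

open Classical in
/-- The number of residues modulo `p` removed by the predicate `bad p`. -/
noncomputable def removedCount (bad : ℕ → ℕ → Prop) (p : ℕ) : ℕ :=
  ((Finset.range p).filter (bad p)).card

/-- The ratio of removed to remaining residues modulo `p`. -/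
noncomputable def sieveWeight (bad : ℕ → ℕ → Prop) (p : ℕ) : ℝ :=
  removedCount bad p / (p - removedCount bad p)

open Classical in
/-- The function modulo `p` which is `-1` on removed residues and constant on the remaining ones,
the constant being chosen so that the mean value is zero. -/
noncomputable def sieveFun (bad : ℕ → ℕ → Prop) (p n : ℕ) : ℝ :=
  if bad p n then -1 else sieveWeight bad p

/-- The squarefree integers in `[1, R]`. -/
def squarefreeUpTo (R : ℕ) : Finset ℕ := (Finset.Icc 1 R).filter Squarefree

theorem mem_squarefreeUpTo {R d : ℕ} : d ∈ squarefreeUpTo R ↔ (1 ≤ d ∧ d ≤ R) ∧ Squarefree d := by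
  simp [squarefreeUpTo]

/-- Selberg's sum `G(R)`, whose reciprocal bounds the density of a sifted set. -/
noncomputable def selbergSum (bad : ℕ → ℕ → Prop) (R : ℕ) : ℝ :=
  ∑ d ∈ squarefreeUpTo R, ∏ p ∈ d.primeFactors, sieveWeight bad p

section Sieve

variable {bad : ℕ → ℕ → Prop}

theorem sieveWeight_nonneg {p : ℕ} (hr : removedCount bad p < p) : 0 ≤ sieveWeight bad p := by
  have : (removedCount bad p : ℝ) < p := by exact_mod_cast hr
  exact div_nonneg (Nat.cast_nonneg _) (by linarith)

theorem abs_sieveFun_le {p : ℕ} (hr : removedCount bad p < p) (n : ℕ) :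
    |sieveFun bad p n| ≤ p := by
  have h1 : (removedCount bad p : ℝ) + 1 ≤ p := by exact_mod_cast hr
  have h0 : (0 : ℝ) ≤ removedCount bad p := Nat.cast_nonneg _
  unfold sieveFun
  split_ifs
  · simp; linarith
  · rw [abs_of_nonneg (sieveWeight_nonneg hr), sieveWeight, div_le_iff₀ (by linarith)]
    nlinarith

theorem sieveFun_periodic {p : ℕ} (hper : ∀ n, bad p (n + p) ↔ bad p n) :
    Function.Periodic (sieveFun bad p) p := by
  intro n
  by_cases h : bad p n
  · rw [sieveFun, sieveFun, if_pos h, if_pos ((hper n).2 h)]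
  · rw [sieveFun, sieveFun, if_neg h, if_neg (mt (hper n).1 h)]

open Classical in
theorem sum_range_ite_bad (p : ℕ) (a b : ℝ) :
    ∑ n ∈ Finset.range p, (if bad p n then a else b) =
      removedCount bad p * a + (p - removedCount bad p) * b := by
  rw [Finset.sum_ite, Finset.sum_const, Finset.sum_const, nsmul_eq_mul, nsmul_eq_mul]
  have h := Finset.card_filter_add_card_filter_not (s := Finset.range p) (bad p)
  rw [Finset.card_range] at h
  have h' : (((Finset.range p).filter fun n => ¬ bad p n).card : ℝ) = p - removedCount bad p := by
    rw [eq_sub_iff_add_eq, add_comm]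
    exact_mod_cast h
  rw [h', removedCount]

theorem sum_sieveFun {p : ℕ} (hr : removedCount bad p < p) :
    ∑ n ∈ Finset.range p, sieveFun bad p n = 0 := by
  have h1 : (removedCount bad p : ℝ) < p := by exact_mod_cast hr
  have h2 : (p : ℝ) - removedCount bad p ≠ 0 := by linarith
  simp only [sieveFun]
  rw [sum_range_ite_bad, sieveWeight]
  field_simp
  ring

theorem sum_sieveFun_sq {p : ℕ} (hr : removedCount bad p < p) :
    ∑ n ∈ Finset.range p, sieveFun bad p n * sieveFun bad p n = p * sieveWeight bad p := by
  have h1 : (removedCount bad p : ℝ) < p := by exact_mod_cast hr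
  have h2 : (p : ℝ) - removedCount bad p ≠ 0 := by linarith
  have : ∀ n, sieveFun bad p n * sieveFun bad p n =
      @ite ℝ (bad p n) (Classical.propDecidable _) 1 (sieveWeight bad p * sieveWeight bad p) := by
    intro n
    unfold sieveFun
    split_ifs <;> simp
  simp only [this]
  rw [sum_range_ite_bad, sieveWeight]
  field_simp
  ring

theorem abs_prod_sieveFun_le {d : ℕ} (hd : d ≠ 0)
    (hr : ∀ p, p.Prime → removedCount bad p < p) (n : ℕ) :
    |∏ p ∈ d.primeFactors, sieveFun bad p n| ≤ d := by
  rw [Finset.abs_prod]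
  calc ∏ p ∈ d.primeFactors, |sieveFun bad p n| ≤ ∏ p ∈ d.primeFactors, (p : ℝ) :=
        Finset.prod_le_prod (fun _ _ => abs_nonneg _)
          fun p hp => abs_sieveFun_le (hr p (Nat.prime_of_mem_primeFactors hp)) n
    _ = ((∏ p ∈ d.primeFactors, p : ℕ) : ℝ) := by push_cast; rfl
    _ ≤ d := by exact_mod_cast Nat.le_of_dvd (Nat.pos_of_ne_zero hd) (Nat.prod_primeFactors_dvd d)

/-- Quasi-orthogonality: over a full period the products attached to two different squarefree
numbers are orthogonal, and an incomplete period contributes at most `R ^ 4`. -/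
theorem sum_prod_sieveFun_mul_le (hper : ∀ p, p.Prime → ∀ n, bad p (n + p) ↔ bad p n)
    (hr : ∀ p, p.Prime → removedCount bad p < p) {R d e : ℕ}
    (hd : d ∈ squarefreeUpTo R) (he : e ∈ squarefreeUpTo R) (N : ℕ) :
    ∑ n ∈ Finset.range N,
        (∏ p ∈ d.primeFactors, sieveFun bad p n) * ∏ p ∈ e.primeFactors, sieveFun bad p n ≤
      N * (if d = e then ∏ p ∈ d.primeFactors, sieveWeight bad p else 0) + (R : ℝ) ^ 4 := by
  rw [mem_squarefreeUpTo] at hd he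
  obtain ⟨⟨hd1, hdR⟩, hdsq⟩ := hd
  obtain ⟨⟨he1, heR⟩, hesq⟩ := he
  set U := d.primeFactors ∪ e.primeFactors with hU
  set M := ∏ p ∈ U, p with hM
  have hUp : ∀ p ∈ U, p.Prime := fun p hp =>
    (Finset.mem_union.1 hp).elim Nat.prime_of_mem_primeFactors Nat.prime_of_mem_primeFactors
  set f : ℕ → ℕ → ℝ := fun p n =>
    (if p ∈ d.primeFactors then sieveFun bad p n else 1) *
      (if p ∈ e.primeFactors then sieveFun bad p n else 1) with hf
  have hfprod : ∀ n, ∏ p ∈ U, f p n =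
      (∏ p ∈ d.primeFactors, sieveFun bad p n) * ∏ p ∈ e.primeFactors, sieveFun bad p n := by
    intro n
    simp only [hf]
    rw [Finset.prod_mul_distrib, Finset.prod_ite_mem, Finset.prod_ite_mem,
      Finset.inter_eq_right.2 Finset.subset_union_left,
      Finset.inter_eq_right.2 Finset.subset_union_right]
  have hfper : ∀ p ∈ U, Function.Periodic (f p) p := by
    intro p hp n
    simp only [hf]
    rw [sieveFun_periodic (hper p (hUp p hp)) n]
  have hMpos : 0 < M := Finset.prod_pos fun p hp => (hUp p hp).pos
  have hMle : M ≤ R * R := by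
    refine le_trans (Nat.le_of_dvd (by positivity) ?_) (Nat.mul_le_mul hdR heR)
    have hU' : U = (d * e).primeFactors := (Nat.primeFactors_mul (by omega) (by omega)).symm
    rw [hM, hU']
    exact Nat.prod_primeFactors_dvd _
  have hmean : ∑ n ∈ Finset.range M, ∏ p ∈ U, f p n =
      M * (if d = e then ∏ p ∈ d.primeFactors, sieveWeight bad p else 0) := by
    rw [sum_range_prod_of_periodic hUp hfper]
    split_ifs with hde
    · subst hde
      have hUd : U = d.primeFactors := by simp [hU]
      rw [hM, hUd, Nat.cast_prod, ← Finset.prod_mul_distrib]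
      refine Finset.prod_congr rfl fun p hp => ?_
      simp only [hf, if_pos hp]
      exact sum_sieveFun_sq (hr p (Nat.prime_of_mem_primeFactors hp))
    · rw [mul_zero]
      have hne : d.primeFactors ≠ e.primeFactors := by
        intro h
        apply hde
        rw [← Nat.prod_primeFactors_of_squarefree hdsq, h,
          Nat.prod_primeFactors_of_squarefree hesq]
      obtain ⟨p, hp⟩ : ∃ p, ¬ (p ∈ d.primeFactors ↔ p ∈ e.primeFactors) := by
        by_contra! h
        exact hne (Finset.ext h)
      have hpU : p ∈ U := by
        rw [hU, Finset.mem_union]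
        tauto
      refine Finset.prod_eq_zero hpU ?_
      rw [← sum_sieveFun (hr p (hUp p hpU))]
      refine Finset.sum_congr rfl fun n _ => ?_
      simp only [hf]
      by_cases h1 : p ∈ d.primeFactors <;> by_cases h2 : p ∈ e.primeFactors <;>
        simp only [h1, h2, if_true, if_false, mul_one, one_mul] <;> tauto
  have hbound : ∀ n, |∏ p ∈ U, f p n| ≤ (R : ℝ) * R := by
    intro n
    rw [hfprod, abs_mul]
    have h1 := abs_prod_sieveFun_le (bad := bad) (d := d) (by omega) hr n
    have h2 := abs_prod_sieveFun_le (bad := bad) (d := e) (by omega) hr n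
    have h3 : (d : ℝ) ≤ R := by exact_mod_cast hdR
    have h4 : (e : ℝ) ≤ R := by exact_mod_cast heR
    exact mul_le_mul (h1.trans h3) (h2.trans h4) (abs_nonneg _) (Nat.cast_nonneg _)
  have hnn : 0 ≤ (if d = e then ∏ p ∈ d.primeFactors, sieveWeight bad p else 0) := by
    split_ifs
    · exact Finset.prod_nonneg fun p hp =>
        sieveWeight_nonneg (hr p (Nat.prime_of_mem_primeFactors hp))
    · exact le_rfl
  have key := sum_range_le_of_periodic hMpos (periodic_prod hfper) hbound hnn hmean N
  simp only [hfprod] at key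
  refine key.trans (add_le_add_right ?_ _)
  have : (M : ℝ) ≤ R * R := by exact_mod_cast hMle
  calc (M : ℝ) * (R * R) ≤ (R * R) * (R * R) := by gcongr
    _ = (R : ℝ) ^ 4 := by ring

theorem card_squarefreeUpTo_le (R : ℕ) : (squarefreeUpTo R).card ≤ R := by
  refine (Finset.card_filter_le _ _).trans ?_
  simp

theorem sum_sq_le_selbergSum (hper : ∀ p, p.Prime → ∀ n, bad p (n + p) ↔ bad p n)
    (hr : ∀ p, p.Prime → removedCount bad p < p) (R N : ℕ) :
    ∑ n ∈ Finset.range N,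
        (∑ d ∈ squarefreeUpTo R, ∏ p ∈ d.primeFactors, sieveFun bad p n) ^ 2 ≤
      N * selbergSum bad R + (R : ℝ) ^ 6 := by
  simp only [sq, Finset.sum_mul_sum]
  rw [Finset.sum_comm]
  have hcard : ((squarefreeUpTo R).card : ℝ) ≤ R := by exact_mod_cast card_squarefreeUpTo_le R
  calc _ ≤ ∑ d ∈ squarefreeUpTo R, ∑ e ∈ squarefreeUpTo R,
        (N * (if d = e then ∏ p ∈ d.primeFactors, sieveWeight bad p else 0) + (R : ℝ) ^ 4) := by
        refine Finset.sum_le_sum fun d hd => ?_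
        rw [Finset.sum_comm]
        exact Finset.sum_le_sum fun e he => sum_prod_sieveFun_mul_le hper hr hd he N
    _ = N * selbergSum bad R +
        ((squarefreeUpTo R).card * (squarefreeUpTo R).card : ℝ) * (R : ℝ) ^ 4 := by
        simp only [Finset.sum_add_distrib, ← Finset.mul_sum, Finset.sum_const, nsmul_eq_mul,
          selbergSum]
        congr 1
        · congr 1
          refine Finset.sum_congr rfl fun d hd => ?_
          rw [Finset.sum_ite_eq, if_pos hd]
        · ring
    _ ≤ N * selbergSum bad R + (R * R : ℝ) * (R : ℝ) ^ 4 := by gcongr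
    _ = _ := by ring

open Classical in
/-- Selberg's upper bound sieve. On the sifted set every local factor takes its positive value, so
the test function equals `selbergSum bad R` there, while its mean square is about the same
number. -/
theorem card_sifted_mul_le (hper : ∀ p, p.Prime → ∀ n, bad p (n + p) ↔ bad p n)
    (hr : ∀ p, p.Prime → removedCount bad p < p) (R N : ℕ) :
    (((Finset.range N).filter fun n => ∀ p, p.Prime → p ≤ R → ¬ bad p n).card : ℝ) *
      selbergSum bad R ^ 2 ≤ N * selbergSum bad R + (R : ℝ) ^ 6 := by
  refine le_trans ?_ (sum_sq_le_selbergSum hper hr R N)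
  rw [← nsmul_eq_mul, ← Finset.sum_const]
  refine (Finset.sum_le_sum fun n hn => ?_).trans
    (Finset.sum_le_sum_of_subset_of_nonneg (Finset.filter_subset _ _) fun _ _ _ => sq_nonneg _)
  rw [Finset.mem_filter] at hn
  apply le_of_eq
  congr 1
  refine Finset.sum_congr rfl fun d hd => Finset.prod_congr rfl fun p hp => ?_
  have hpR : p ≤ R := (Nat.le_of_mem_primeFactors hp).trans (mem_squarefreeUpTo.1 hd).1.2
  rw [sieveFun, if_neg (hn.2 p (Nat.prime_of_mem_primeFactors hp) hpR)]

theorem one_le_selbergSum (hr : ∀ p, p.Prime → removedCount bad p < p) {R : ℕ} (hR : 1 ≤ R) :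
    1 ≤ selbergSum bad R := by
  have h := Finset.single_le_sum
    (f := fun d : ℕ => ∏ p ∈ d.primeFactors, sieveWeight bad p) (s := squarefreeUpTo R)
    (fun d _ => Finset.prod_nonneg fun p hp =>
      sieveWeight_nonneg (hr p (Nat.prime_of_mem_primeFactors hp)))
    (mem_squarefreeUpTo.2 ⟨⟨le_rfl, hR⟩, squarefree_one⟩)
  simpa [selbergSum] using h

end Sieve

/-! ### Lower bound for Selberg's sum -/

theorem sum_le_sum_of_forall_exists_preimage {α β : Type*} {s : Finset α} {t : Finset β}
    {f : α → ℝ} {g : β → ℝ} (φ : β → α) (hg : ∀ x ∈ t, 0 ≤ g x)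
    (h : ∀ a ∈ s, ∃ x ∈ t, φ x = a ∧ f a ≤ g x) : ∑ a ∈ s, f a ≤ ∑ x ∈ t, g x := by
  classical
  obtain rfl | ⟨a₀, ha₀⟩ := s.eq_empty_or_nonempty
  · simpa using Finset.sum_nonneg hg
  have : Nonempty β := ⟨(h a₀ ha₀).choose⟩
  choose! i hi hφ hle using h
  calc ∑ a ∈ s, f a ≤ ∑ a ∈ s, g (i a) := Finset.sum_le_sum hle
    _ = ∑ x ∈ s.image i, g x := by
      rw [Finset.sum_image]
      intro a ha b hb hab
      rw [← hφ a ha, ← hφ b hb, hab]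
    _ ≤ ∑ x ∈ t, g x := Finset.sum_le_sum_of_subset_of_nonneg
      (Finset.image_subset_iff.2 hi) fun x hx _ => hg x hx

theorem sum_Icc_inv_sq_le_two (y : ℕ) : ∑ m ∈ Finset.Icc 1 y, ((m : ℝ) ^ 2)⁻¹ ≤ 2 := by
  have h := sum_Ioo_inv_sq_le (α := ℝ) 0 (y + 1)
  have e : Finset.Ioo 0 (y + 1) = Finset.Icc 1 y := by
    ext; simp only [Finset.mem_Ioo, Finset.mem_Icc]; omega
  rw [e] at h
  simpa using h

theorem sum_inv_le_two_mul_sum_squarefree (y : ℕ) :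
    ∑ n ∈ Finset.Icc 1 y, (n : ℝ)⁻¹ ≤ 2 * ∑ s ∈ squarefreeUpTo y, (s : ℝ)⁻¹ := by
  calc ∑ n ∈ Finset.Icc 1 y, (n : ℝ)⁻¹
      ≤ ∑ x ∈ Finset.Icc 1 y ×ˢ squarefreeUpTo y, ((x.1 : ℝ) ^ 2)⁻¹ * (x.2 : ℝ)⁻¹ := by
        refine sum_le_sum_of_forall_exists_preimage (fun x => x.1 ^ 2 * x.2)
          (fun _ _ => by positivity) fun n hn => ?_
        rw [Finset.mem_Icc] at hn
        obtain ⟨s, m, hs0, hm0, hms, hs⟩ := Nat.sq_mul_squarefree_of_pos hn.1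
        have hs' : s ≤ n := Nat.le_of_dvd hn.1 ⟨m ^ 2, by rw [← hms]; ring⟩
        have hm' : m ≤ n := Nat.le_of_dvd hn.1 ⟨m * s, by rw [← hms]; ring⟩
        refine ⟨(m, s), ?_, hms, ?_⟩
        · simp only [Finset.mem_product, Finset.mem_Icc, mem_squarefreeUpTo]
          exact ⟨⟨hm0, by omega⟩, ⟨hs0, by omega⟩, hs⟩
        · rw [← hms]; push_cast; rw [mul_inv]
    _ = (∑ m ∈ Finset.Icc 1 y, ((m : ℝ) ^ 2)⁻¹) * ∑ s ∈ squarefreeUpTo y, (s : ℝ)⁻¹ := by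
        rw [Finset.sum_mul_sum, Finset.sum_product]
    _ ≤ _ := by
        gcongr
        exact sum_Icc_inv_sq_le_two y

/-- The squarefree integers in `[1, y]` that are coprime to `q`. -/
def squarefreeCoprimeUpTo (q y : ℕ) : Finset ℕ := (squarefreeUpTo y).filter (Nat.Coprime q)

/-- The sum of the reciprocals of the divisors of `q`, that is `σ(q) / q`. -/
noncomputable def sumInvDivisors (q : ℕ) : ℝ := ∑ d ∈ q.divisors, (d : ℝ)⁻¹

/-- Each squarefree `n` factors as `gcd n q` times a number coprime to `q`. -/
theorem sum_squarefree_le_sumInvDivisors_mul {q : ℕ} (hq : q ≠ 0) (y : ℕ) :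
    ∑ n ∈ squarefreeUpTo y, (n : ℝ)⁻¹ ≤
      sumInvDivisors q * ∑ a ∈ squarefreeCoprimeUpTo q y, (a : ℝ)⁻¹ := by
  rw [sumInvDivisors, Finset.sum_mul_sum, ← Finset.sum_product']
  refine sum_le_sum_of_forall_exists_preimage (fun x => x.1 * x.2)
    (fun _ _ => by positivity) fun n hn => ?_
  rw [mem_squarefreeUpTo] at hn
  obtain ⟨⟨hn1, hny⟩, hnsq⟩ := hn
  obtain ⟨a, ha⟩ := Nat.gcd_dvd_left n q
  have ha1 : 1 ≤ a := Nat.pos_of_ne_zero fun h => by rw [h] at ha; omega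
  have han : a ≤ n := Nat.le_of_dvd hn1 ⟨n.gcd q, by rw [mul_comm]; exact ha⟩
  have hsq : Squarefree (n.gcd q * a) := ha ▸ hnsq
  have hcop : (n.gcd q).Coprime a := Nat.coprime_of_squarefree_mul hsq
  refine ⟨(n.gcd q, a), ?_, ha.symm, ?_⟩
  · simp only [Finset.mem_product, Nat.mem_divisors, squarefreeCoprimeUpTo, Finset.mem_filter,
      mem_squarefreeUpTo]
    refine ⟨⟨Nat.gcd_dvd_right n q, hq⟩, ⟨⟨ha1, han.trans hny⟩, hsq.of_mul_right⟩, ?_⟩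
    refine Nat.Coprime.symm (Nat.coprime_of_dvd fun p hp hpa hpq => ?_)
    have hpn : p ∣ n := hpa.trans ⟨n.gcd q, by rw [mul_comm]; exact ha⟩
    exact hp.one_lt.ne' (Nat.eq_one_of_dvd_coprimes hcop (Nat.dvd_gcd hpn hpq) hpa)
  · conv_lhs => rw [ha]
    push_cast
    rw [mul_inv]

/-- Dividing a pair of squarefree numbers by its greatest common divisor `t` costs a factor
`1 / t ^ 2`, and these sum to at most `2`. -/
theorem sum_mul_sum_le_two_mul_sum_coprime (q y : ℕ) :
    (∑ a ∈ squarefreeCoprimeUpTo q y, (a : ℝ)⁻¹) * ∑ b ∈ squarefreeUpTo y, (b : ℝ)⁻¹ ≤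
      2 * ∑ x ∈ (squarefreeCoprimeUpTo q y ×ˢ squarefreeUpTo y).filter
        (fun x => x.1.Coprime x.2), ((x.1 * x.2 : ℕ) : ℝ)⁻¹ := by
  rw [Finset.sum_mul_sum, ← Finset.sum_product']
  calc _ ≤ ∑ z ∈ Finset.Icc 1 y ×ˢ (squarefreeCoprimeUpTo q y ×ˢ squarefreeUpTo y).filter
        (fun x => x.1.Coprime x.2), ((z.1 : ℝ) ^ 2)⁻¹ * ((z.2.1 * z.2.2 : ℕ) : ℝ)⁻¹ := by
        refine sum_le_sum_of_forall_exists_preimage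
          (fun z => (z.1 * z.2.1, z.1 * z.2.2)) (fun _ _ => by positivity) ?_
        rintro ⟨a, b⟩ hab
        simp only [Finset.mem_product, squarefreeCoprimeUpTo, Finset.mem_filter,
          mem_squarefreeUpTo] at hab
        obtain ⟨⟨⟨⟨ha1, hay⟩, hasq⟩, haq⟩, ⟨hb1, hby⟩, hbsq⟩ := hab
        obtain ⟨t, a', b', ht, hcop, ha, hb⟩ := Nat.exists_coprime' (m := a) (n := b)
          (Nat.gcd_pos_of_pos_left _ ha1)
        have hda : a' ∣ a := ⟨t, ha⟩
        have hdb : b' ∣ b := ⟨t, hb⟩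
        have hta : t ∣ a := ⟨a', by rw [ha]; ring⟩
        refine ⟨(t, (a', b')), ?_, ?_, ?_⟩
        · simp only [Finset.mem_product, squarefreeCoprimeUpTo, Finset.mem_filter,
            mem_squarefreeUpTo, Finset.mem_Icc]
          exact ⟨⟨ht, (Nat.le_of_dvd ha1 hta).trans hay⟩,
            ⟨⟨⟨⟨Nat.pos_of_dvd_of_pos hda ha1, (Nat.le_of_dvd ha1 hda).trans hay⟩,
              hasq.squarefree_of_dvd hda⟩, haq.coprime_dvd_right hda⟩,
              ⟨Nat.pos_of_dvd_of_pos hdb hb1, (Nat.le_of_dvd hb1 hdb).trans hby⟩,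
              hbsq.squarefree_of_dvd hdb⟩, hcop⟩
        · rw [ha, hb]; simp [mul_comm]
        · apply le_of_eq
          rw [ha, hb]; push_cast
          simp only [mul_inv, sq]
          ring
    _ = (∑ m ∈ Finset.Icc 1 y, ((m : ℝ) ^ 2)⁻¹) *
        ∑ x ∈ (squarefreeCoprimeUpTo q y ×ˢ squarefreeUpTo y).filter
          (fun x => x.1.Coprime x.2), ((x.1 * x.2 : ℕ) : ℝ)⁻¹ := by
        rw [Finset.sum_mul_sum, Finset.sum_product]
    _ ≤ _ := by
        gcongr
        exact sum_Icc_inv_sq_le_two y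

theorem card_coprime_divisors_le {d : ℕ} (hd : Squarefree d) (q : ℕ) :
    (d.divisors.filter (Nat.Coprime q)).card ≤ 2 ^ (d.primeFactors.filter fun p => ¬ p ∣ q).card := by
  rw [← Finset.card_powerset]
  refine Finset.card_le_card_of_injOn Nat.primeFactors ?_ ?_
  · intro a ha
    simp only [Finset.coe_filter, Nat.mem_divisors, Set.mem_ofPred_eq] at ha
    simp only [Finset.coe_powerset, Set.mem_preimage, Set.mem_powerset_iff, Finset.coe_subset]
    intro p hp
    have hpp := Nat.prime_of_mem_primeFactors hp
    have hpa := Nat.dvd_of_mem_primeFactors hp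
    rw [Finset.mem_filter, Nat.mem_primeFactors]
    refine ⟨⟨hpp, hpa.trans ha.1.1, ha.1.2⟩, fun hpq => ?_⟩
    exact hpp.one_lt.ne' (Nat.eq_one_of_dvd_coprimes ha.2 hpq hpa)
  · intro a ha b hb hab
    simp only [Finset.coe_filter, Nat.mem_divisors, Set.mem_ofPred_eq] at ha hb
    rw [← Nat.prod_primeFactors_of_squarefree (hd.squarefree_of_dvd ha.1.1), hab,
      Nat.prod_primeFactors_of_squarefree (hd.squarefree_of_dvd hb.1.1)]

section LowerBound

variable {bad : ℕ → ℕ → Prop}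

theorem removedCount_div_le_sieveWeight {p : ℕ} (hr : removedCount bad p < p) :
    removedCount bad p / (p : ℝ) ≤ sieveWeight bad p := by
  have h1 : (removedCount bad p : ℝ) < p := by exact_mod_cast hr
  have h0 : (0 : ℝ) ≤ removedCount bad p := Nat.cast_nonneg _
  unfold sieveWeight
  gcongr
  · linarith

theorem card_coprime_divisors_div_le_prod_sieveWeight
    (hr : ∀ p, p.Prime → removedCount bad p < p) {q : ℕ}
    (h1 : ∀ p, p.Prime → 1 ≤ removedCount bad p)
    (h2 : ∀ p, p.Prime → ¬ p ∣ q → 2 ≤ removedCount bad p) {d : ℕ} (hd : Squarefree d) :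
    ((d.divisors.filter (Nat.Coprime q)).card : ℝ) * (d : ℝ)⁻¹ ≤
      ∏ p ∈ d.primeFactors, sieveWeight bad p := by
  have hc : (d.divisors.filter (Nat.Coprime q)).card ≤ ∏ p ∈ d.primeFactors, removedCount bad p := by
    refine (card_coprime_divisors_le hd q).trans ?_
    rw [← Finset.prod_const]
    refine (Finset.prod_le_prod' fun p hp => ?_).trans
      (Finset.prod_le_prod_of_subset_of_one_le' (Finset.filter_subset _ _) fun p hp _ => ?_)
    · rw [Finset.mem_filter] at hp
      exact h2 p (Nat.prime_of_mem_primeFactors hp.1) hp.2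
    · exact h1 p (Nat.prime_of_mem_primeFactors hp)
  calc ((d.divisors.filter (Nat.Coprime q)).card : ℝ) * (d : ℝ)⁻¹
      ≤ ((∏ p ∈ d.primeFactors, removedCount bad p : ℕ) : ℝ) * (d : ℝ)⁻¹ := by gcongr
    _ = ∏ p ∈ d.primeFactors, removedCount bad p / (p : ℝ) := by
        conv_lhs => rw [← Nat.prod_primeFactors_of_squarefree hd]
        rw [Nat.primeFactors_prod fun p hp => Nat.prime_of_mem_primeFactors hp]
        push_cast
        rw [Finset.prod_div_distrib, div_eq_mul_inv]
    _ ≤ _ := Finset.prod_le_prod (fun _ _ => by positivity) fun p hp =>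
        removedCount_div_le_sieveWeight (hr p (Nat.prime_of_mem_primeFactors hp))

/-- The pair `(a, b)` is counted under the squarefree number `d = a * b`, of which `a` is a divisor
coprime to `q`. -/
theorem sum_coprime_le_selbergSum
    (hr : ∀ p, p.Prime → removedCount bad p < p) {q : ℕ}
    (h1 : ∀ p, p.Prime → 1 ≤ removedCount bad p)
    (h2 : ∀ p, p.Prime → ¬ p ∣ q → 2 ≤ removedCount bad p) (y : ℕ) :
    ∑ x ∈ (squarefreeCoprimeUpTo q y ×ˢ squarefreeUpTo y).filter
        (fun x => x.1.Coprime x.2), ((x.1 * x.2 : ℕ) : ℝ)⁻¹ ≤ selbergSum bad (y ^ 2) := by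
  calc _ ≤ ∑ z ∈ (squarefreeUpTo (y ^ 2)).sigma fun d => d.divisors.filter (Nat.Coprime q),
        (z.1 : ℝ)⁻¹ := by
        refine sum_le_sum_of_forall_exists_preimage (fun z => (z.2, z.1 / z.2))
          (fun _ _ => by positivity) ?_
        rintro ⟨a, b⟩ hab
        simp only [Finset.mem_product, squarefreeCoprimeUpTo, Finset.mem_filter,
          mem_squarefreeUpTo] at hab
        obtain ⟨⟨⟨⟨⟨ha1, hay⟩, hasq⟩, haq⟩, ⟨hb1, hby⟩, hbsq⟩, hcop⟩ := hab
        refine ⟨⟨a * b, a⟩, ?_, ?_, le_rfl⟩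
        · simp only [Finset.mem_sigma, mem_squarefreeUpTo, Finset.mem_filter, Nat.mem_divisors]
          refine ⟨⟨⟨Nat.mul_pos ha1 hb1, ?_⟩, (Nat.squarefree_mul hcop).2 ⟨hasq, hbsq⟩⟩,
            ⟨Dvd.intro _ rfl, (Nat.mul_pos ha1 hb1).ne'⟩, haq⟩
          rw [sq]
          exact Nat.mul_le_mul hay hby
        · simp [Nat.mul_div_cancel_left b ha1]
    _ = ∑ d ∈ squarefreeUpTo (y ^ 2),
        ((d.divisors.filter (Nat.Coprime q)).card : ℝ) * (d : ℝ)⁻¹ := by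
        rw [Finset.sum_sigma]
        simp
    _ ≤ _ := Finset.sum_le_sum fun d hd =>
        card_coprime_divisors_div_le_prod_sieveWeight hr h1 h2 (mem_squarefreeUpTo.1 hd).2

/-- If every prime removes a residue, and every prime not dividing `q` removes two, then Selberg's
sum has the order of magnitude `log ^ 2` expected in dimension two. -/
theorem log_sq_le_selbergSum
    (hr : ∀ p, p.Prime → removedCount bad p < p) {q : ℕ} (hq : q ≠ 0)
    (h1 : ∀ p, p.Prime → 1 ≤ removedCount bad p)
    (h2 : ∀ p, p.Prime → ¬ p ∣ q → 2 ≤ removedCount bad p) (y : ℕ) :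
    Real.log (y + 1) ^ 2 ≤ 8 * sumInvDivisors q * selbergSum bad (y ^ 2) := by
  set A := ∑ a ∈ squarefreeCoprimeUpTo q y, (a : ℝ)⁻¹ with hA
  set B := ∑ b ∈ squarefreeUpTo y, (b : ℝ)⁻¹ with hB
  have hs0 : 0 ≤ sumInvDivisors q := Finset.sum_nonneg fun _ _ => by positivity
  have hB0 : 0 ≤ B := Finset.sum_nonneg fun _ _ => by positivity
  have hlog : Real.log (y + 1) ≤ 2 * B := by
    refine le_trans ?_ (sum_inv_le_two_mul_sum_squarefree y)
    have h := log_add_one_le_harmonic y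
    rw [harmonic_eq_sum_Icc] at h
    push_cast at h
    exact h
  have hlog0 : 0 ≤ Real.log (y + 1) := Real.log_nonneg (by simp)
  have hBA : B ≤ sumInvDivisors q * A := sum_squarefree_le_sumInvDivisors_mul hq y
  have hAB : A * B ≤ 2 * selbergSum bad (y ^ 2) :=
    (sum_mul_sum_le_two_mul_sum_coprime q y).trans
      (by gcongr; exact sum_coprime_le_selbergSum hr h1 h2 y)
  calc Real.log (y + 1) ^ 2 ≤ (2 * B) ^ 2 := by gcongr
    _ = 4 * (B * B) := by ring
    _ ≤ 4 * (sumInvDivisors q * A * B) := by gcongr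
    _ = 4 * sumInvDivisors q * (A * B) := by ring
    _ ≤ 4 * sumInvDivisors q * (2 * selbergSum bad (y ^ 2)) := by gcongr
    _ = _ := by ring

end LowerBound

/-! ### Prime pairs with a given difference -/

/-- The condition removing `n` at the prime `p` when sifting for primes `n` with `n + h` prime.
At `p = 2` only the residue `0` is removed: removing both residues for odd `h` would leave
nothing. -/
def PairBad (h p n : ℕ) : Prop := p ∣ n ∨ (p ≠ 2 ∧ p ∣ n + h)

theorem pairBad_add_self_iff (h p n : ℕ) : PairBad h p (n + p) ↔ PairBad h p n := by
  unfold PairBad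
  rw [Nat.dvd_add_self_right, add_right_comm, Nat.dvd_add_self_right]

theorem removedCount_pairBad_lt (h : ℕ) {p : ℕ} (hp : p.Prime) :
    removedCount (PairBad h) p < p := by
  classical
  obtain ⟨n, hn, hnb⟩ : ∃ n, n < p ∧ ¬ PairBad h p n := by
    by_cases h2 : p = 2
    · exact ⟨1, hp.one_lt, by simp [PairBad, h2]⟩
    · have h3 : 2 < p := lt_of_le_of_ne hp.two_le (Ne.symm h2)
      by_contra! hcon
      have c1 := hcon 1 hp.one_lt
      have c2 := hcon 2 h3
      have n1 : ¬ p ∣ 1 := Nat.not_dvd_of_pos_of_lt one_pos hp.one_lt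
      have n2 : ¬ p ∣ 2 := Nat.not_dvd_of_pos_of_lt two_pos h3
      have d1 : p ∣ 1 + h := (c1.resolve_left n1).2
      have d2 : p ∣ 2 + h := (c2.resolve_left n2).2
      have := Nat.dvd_sub d2 d1
      rw [show 2 + h - (1 + h) = 1 by omega] at this
      exact n1 this
  calc removedCount (PairBad h) p < (Finset.range p).card := by
        unfold removedCount
        refine Finset.card_lt_card (Finset.filter_ssubset.2 ⟨n, Finset.mem_range.2 hn, hnb⟩)
    _ = p := Finset.card_range p

theorem one_le_removedCount_pairBad (h : ℕ) {p : ℕ} (hp : p.Prime) :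
    1 ≤ removedCount (PairBad h) p := by
  classical
  unfold removedCount
  exact Finset.card_pos.2 ⟨0, by simp [PairBad, hp.pos]⟩

theorem two_le_removedCount_pairBad {h p : ℕ} (hp : p.Prime) (hph : ¬ p ∣ 2 * h) :
    2 ≤ removedCount (PairBad h) p := by
  classical
  have hp2 : p ≠ 2 := by rintro rfl; exact hph (Dvd.intro _ rfl)
  have hph' : ¬ p ∣ h := fun hd => hph (hd.mul_left 2)
  have hmod : 0 < h % p := Nat.pos_of_ne_zero fun h0 => hph' (Nat.dvd_of_mod_eq_zero h0)
  have hlt : h % p < p := Nat.mod_lt _ hp.pos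
  have hdvd : p ∣ p - h % p + h := by
    refine ⟨1 + h / p, ?_⟩
    have := Nat.div_add_mod h p
    rw [mul_add, mul_one]
    omega
  calc 2 = ({0, p - h % p} : Finset ℕ).card := by
        rw [Finset.card_pair]
        omega
    _ ≤ removedCount (PairBad h) p := by
        unfold removedCount
        refine Finset.card_le_card ?_
        intro n hn
        simp only [Finset.mem_insert, Finset.mem_singleton] at hn
        rw [Finset.mem_filter, Finset.mem_range]
        rcases hn with rfl | rfl
        · exact ⟨hp.pos, Or.inl (dvd_zero p)⟩
        · exact ⟨by omega, Or.inr ⟨hp2, hdvd⟩⟩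

/-- The number of primes `n < N` such that `n + h` is prime. -/
def primePairCount (h N : ℕ) : ℕ :=
  ((Finset.range N).filter fun n => n.Prime ∧ (n + h).Prime).card

theorem primePairCount_le_selberg (h N R : ℕ) (hR : 1 ≤ R) :
    (primePairCount h N : ℝ) ≤ N / selbergSum (PairBad h) R + 3 * (R : ℝ) ^ 6 := by
  classical
  set G := selbergSum (PairBad h) R with hG
  have hr := fun (p : ℕ) (hp : p.Prime) => removedCount_pairBad_lt h hp
  have hG1 : 1 ≤ G := one_le_selbergSum hr hR
  have hS := card_sifted_mul_le (fun p _ => pairBad_add_self_iff h p) hr R N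
  set S := (Finset.range N).filter fun n => ∀ p, p.Prime → p ≤ R → ¬ PairBad h p n with hSdef
  have hcard : primePairCount h N ≤ (R + 1) + S.card := by
    rw [← Finset.card_range (R + 1)]
    refine (Finset.card_le_card ?_).trans (Finset.card_union_le _ _)
    intro n hn
    rw [Finset.mem_filter] at hn
    rw [Finset.mem_union, Finset.mem_range, hSdef, Finset.mem_filter]
    by_cases hnR : n < R + 1
    · exact Or.inl hnR
    · refine Or.inr ⟨hn.1, fun p hp hpR hbad => ?_⟩
      rcases hbad with hd | ⟨_, hd⟩
      · have := (Nat.prime_dvd_prime_iff_eq hp hn.2.1).1 hd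
        omega
      · have := (Nat.prime_dvd_prime_iff_eq hp hn.2.2).1 hd
        omega
  have hScard : (S.card : ℝ) ≤ N / G + (R : ℝ) ^ 6 := by
    have hG0 : 0 < G := by linarith
    have h1 : (S.card : ℝ) * G ^ 2 ≤ (N / G + (R : ℝ) ^ 6) * G ^ 2 := by
      refine hS.trans ?_
      have e : (N / G + (R : ℝ) ^ 6) * G ^ 2 = N * G + (R : ℝ) ^ 6 * G ^ 2 := by
        field_simp
      rw [e]
      gcongr
      exact le_mul_of_one_le_right (by positivity) (one_le_pow₀ hG1)
    exact le_of_mul_le_mul_right h1 (by positivity)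
  have hR1 : (1 : ℝ) ≤ R := by exact_mod_cast hR
  have hR6 : (R : ℝ) ≤ (R : ℝ) ^ 6 := le_self_pow₀ hR1 (by norm_num)
  have hc : (primePairCount h N : ℝ) ≤ (R + 1) + S.card := by exact_mod_cast hcard
  linarith

theorem primePairCount_le {h : ℕ} (hh : h ≠ 0) (N : ℕ) {y : ℕ} (hy : 1 ≤ y) :
    (primePairCount h N : ℝ) ≤
      8 * N / Real.log (y + 1) ^ 2 * sumInvDivisors (2 * h) + 3 * (y : ℝ) ^ 12 := by
  have hr := fun (p : ℕ) (hp : p.Prime) => removedCount_pairBad_lt h hp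
  have h1 := primePairCount_le_selberg h N (y ^ 2) (Nat.one_le_pow _ _ hy)
  have h2 := log_sq_le_selbergSum hr (q := 2 * h) (by omega)
    (fun p hp => one_le_removedCount_pairBad h hp)
    (fun p hp => two_le_removedCount_pairBad hp) y
  have hG : 1 ≤ selbergSum (PairBad h) (y ^ 2) := one_le_selbergSum hr (Nat.one_le_pow _ _ hy)
  have hl : 0 < Real.log (y + 1) := Real.log_pos (by
    have : (1 : ℝ) ≤ y := by exact_mod_cast hy
    linarith)
  refine h1.trans (add_le_add ?_ (le_of_eq ?_))
  · rw [div_mul_eq_mul_div, div_le_div_iff₀ (by linarith) (by positivity)]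
    calc N * Real.log (y + 1) ^ 2
        ≤ N * (8 * sumInvDivisors (2 * h) * selbergSum (PairBad h) (y ^ 2)) := by gcongr
      _ = _ := by ring
  · push_cast; ring

/-! ### Averaging over the difference -/

theorem sum_sumInvDivisors_le (M : ℕ) : ∑ m ∈ Finset.Ioc 0 M, sumInvDivisors m ≤ 2 * M := by
  have h1 : ∀ m ∈ Finset.Ioc 0 M, sumInvDivisors m =
      ∑ d ∈ Finset.Ioc 0 M, if d ∣ m then (d : ℝ)⁻¹ else 0 := by
    intro m hm
    rw [Finset.mem_Ioc] at hm
    rw [sumInvDivisors, ← Finset.sum_filter]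
    refine Finset.sum_congr ?_ fun _ _ => rfl
    ext d
    simp only [Nat.mem_divisors, Finset.mem_filter, Finset.mem_Ioc]
    constructor
    · rintro ⟨hd, h0⟩
      exact ⟨⟨Nat.pos_of_dvd_of_pos hd hm.1, (Nat.le_of_dvd hm.1 hd).trans hm.2⟩, hd⟩
    · rintro ⟨_, hd⟩
      exact ⟨hd, hm.1.ne'⟩
  rw [Finset.sum_congr rfl h1, Finset.sum_comm]
  calc _ ≤ ∑ d ∈ Finset.Ioc 0 M, (M : ℝ) * ((d : ℝ) ^ 2)⁻¹ := by
        refine Finset.sum_le_sum fun d hd => ?_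
        rw [← Finset.sum_filter, Finset.sum_const, Nat.Ioc_filter_dvd_card_eq_div, nsmul_eq_mul]
        calc ((M / d : ℕ) : ℝ) * (d : ℝ)⁻¹ ≤ (M / d : ℝ) * (d : ℝ)⁻¹ := by
              gcongr
              exact Nat.cast_div_le
          _ = _ := by rw [sq, mul_inv]; ring
    _ = M * ∑ d ∈ Finset.Icc 1 M, ((d : ℝ) ^ 2)⁻¹ := by rw [← Finset.mul_sum]; rfl
    _ ≤ M * 2 := by gcongr; exact sum_Icc_inv_sq_le_two M
    _ = _ := by ring

theorem sum_sumInvDivisors_two_mul_le (k : ℕ) :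
    ∑ h ∈ Finset.Icc 1 k, sumInvDivisors (2 * h) ≤ 4 * k := by
  have h := sum_sumInvDivisors_le (2 * k)
  push_cast at h
  refine le_trans ?_ (h.trans (le_of_eq (by ring)))
  refine sum_le_sum_of_forall_exists_preimage (· / 2)
    (fun _ _ => Finset.sum_nonneg fun _ _ => by positivity) fun a ha => ?_
  rw [Finset.mem_Icc] at ha
  exact ⟨2 * a, Finset.mem_Ioc.2 (by omega), by simp, le_rfl⟩

/-- On average over `h ≤ k` there are `O(X / log ^ 2 X)` primes up to `2 X` forming a prime pair
with difference `h`. -/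
theorem sum_primePairCount_le {X : ℝ} (hX : 2 ≤ X) {N : ℕ} (hN : (N : ℝ) ≤ 2 * X) (k : ℕ) :
    ∑ h ∈ Finset.Icc 1 k, (primePairCount h N : ℝ) ≤ 36912 * (k * (X / Real.log X ^ 2)) := by
  have hX0 : 0 < X := by linarith
  have hL : 0 < Real.log X := Real.log_pos (by linarith)
  -- The sifting level is `R = y ^ 2`, so that the error term `R ^ 6 = y ^ 12` is at most `√X`.
  set z : ℝ := X ^ (1 / 24 : ℝ) with hz
  have hz1 : 1 ≤ z := Real.one_le_rpow (by linarith) (by norm_num)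
  set y := ⌊z⌋₊ with hy
  have hy1 : 1 ≤ y := Nat.le_floor (by simpa using hz1)
  have hyz : (y : ℝ) ≤ z := Nat.floor_le (by linarith)
  have hlog : Real.log X / 24 ≤ Real.log (y + 1) := by
    have : Real.log z ≤ Real.log (y + 1) :=
      Real.log_le_log (by linarith) (Nat.lt_floor_add_one z).le
    rw [hz, Real.log_rpow hX0] at this
    linarith
  have hy12 : (y : ℝ) ^ 12 ≤ X ^ (1 / 2 : ℝ) := by
    calc (y : ℝ) ^ 12 ≤ z ^ 12 := by gcongr
      _ = X ^ (1 / 2 : ℝ) := by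
        rw [hz, ← Real.rpow_natCast, ← Real.rpow_mul hX0.le]
        norm_num
  have hL4 : Real.log X ≤ 4 * X ^ (1 / 4 : ℝ) := by
    have := Real.log_le_rpow_div hX0.le (ε := 1 / 4) (by norm_num)
    linarith
  have hsq : X ^ (1 / 2 : ℝ) ≤ 16 * (X / Real.log X ^ 2) := by
    rw [← mul_div_assoc, le_div_iff₀ (by positivity)]
    calc X ^ (1 / 2 : ℝ) * Real.log X ^ 2
        ≤ X ^ (1 / 2 : ℝ) * (4 * X ^ (1 / 4 : ℝ)) ^ 2 := by gcongr
      _ = 16 * (X ^ (1 / 2 : ℝ) * (X ^ (1 / 4 : ℝ) * X ^ (1 / 4 : ℝ))) := by ring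
      _ = 16 * X := by
        rw [← Real.rpow_add hX0, ← Real.rpow_add hX0]
        norm_num
  have hmain : 8 * N / Real.log (y + 1) ^ 2 ≤ 9216 * (X / Real.log X ^ 2) := by
    calc 8 * N / Real.log (y + 1) ^ 2 ≤ 8 * (2 * X) / (Real.log X / 24) ^ 2 := by gcongr
      _ = _ := by field_simp; ring
  calc ∑ h ∈ Finset.Icc 1 k, (primePairCount h N : ℝ)
      ≤ ∑ h ∈ Finset.Icc 1 k, (8 * N / Real.log (y + 1) ^ 2 * sumInvDivisors (2 * h) +
          3 * (y : ℝ) ^ 12) := by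
        refine Finset.sum_le_sum fun h hh => primePairCount_le ?_ N hy1
        rw [Finset.mem_Icc] at hh
        omega
    _ = 8 * N / Real.log (y + 1) ^ 2 * ∑ h ∈ Finset.Icc 1 k, sumInvDivisors (2 * h) +
          k * (3 * (y : ℝ) ^ 12) := by
        rw [Finset.sum_add_distrib, ← Finset.mul_sum]
        simp
    _ ≤ 9216 * (X / Real.log X ^ 2) * (4 * k) + k * (3 * (16 * (X / Real.log X ^ 2))) := by
        have h3 := hy12.trans hsq
        gcongr
        · exact Finset.sum_nonneg fun _ _ => Finset.sum_nonneg fun _ _ => by positivity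
        · exact sum_sumInvDivisors_two_mul_le k
    _ = _ := by ring

/-! ### The second moment -/

/-- The number of elements of `P` in `(m, m + k]`. -/
def windowCount (P : Finset ℕ) (k m : ℕ) : ℕ := (P.filter fun p => m < p ∧ p ≤ m + k).card

theorem card_starts_eq {k N p : ℕ} (hk : k < p) (hp : p ≤ N) :
    ((Finset.Icc 1 N).filter fun m => m < p ∧ p ≤ m + k).card = k := by
  have : (Finset.Icc 1 N).filter (fun m => m < p ∧ p ≤ m + k) = Finset.Ico (p - k) p := by
    ext m
    simp only [Finset.mem_filter, Finset.mem_Icc, Finset.mem_Ico]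
    omega
  rw [this, Nat.card_Ico]
  omega

theorem sum_windowCount {P : Finset ℕ} {k N : ℕ} (hP : ∀ p ∈ P, k < p ∧ p ≤ N) :
    ∑ m ∈ Finset.Icc 1 N, windowCount P k m = P.card * k := by
  have h := Finset.sum_card_bipartiteAbove_eq_sum_card_bipartiteBelow
    (s := Finset.Icc 1 N) (t := P) (fun m p => m < p ∧ p ≤ m + k)
  simp only [Finset.bipartiteAbove, Finset.bipartiteBelow] at h
  unfold windowCount
  rw [h, Finset.sum_congr rfl fun p hp => card_starts_eq (hP p hp).1 (hP p hp).2]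
  simp

theorem windowCount_sq_le (P : Finset ℕ) (k m : ℕ) :
    windowCount P k m ^ 2 ≤ 2 * (((P ×ˢ Finset.range k).filter fun x => x.1 + x.2 ∈ P).filter
      fun x => m < x.1 ∧ x.1 ≤ m + k).card := by
  set T := ((P ×ˢ Finset.range k).filter fun x => x.1 + x.2 ∈ P).filter
      fun x => m < x.1 ∧ x.1 ≤ m + k with hT
  rw [sq, windowCount, ← Finset.card_product, two_mul]
  have hsub : (P.filter fun p => m < p ∧ p ≤ m + k) ×ˢ (P.filter fun p => m < p ∧ p ≤ m + k) ⊆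
      T.image (fun x => (x.1, x.1 + x.2)) ∪ T.image (fun x => (x.1 + x.2, x.1)) := by
    rintro ⟨p, q⟩ hpq
    simp only [Finset.mem_product, Finset.mem_filter] at hpq
    obtain ⟨⟨hp, hmp, hpm⟩, hq, hmq, hqm⟩ := hpq
    rw [Finset.mem_union, Finset.mem_image, Finset.mem_image]
    rcases le_total p q with hle | hle
    · refine Or.inl ⟨(p, q - p), ?_, by simp [Nat.add_sub_cancel' hle]⟩
      simp only [hT, Finset.mem_filter, Finset.mem_product, Finset.mem_range,
        Nat.add_sub_cancel' hle]
      exact ⟨⟨⟨hp, by omega⟩, hq⟩, hmp, hpm⟩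
    · refine Or.inr ⟨(q, p - q), ?_, by simp [Nat.add_sub_cancel' hle]⟩
      simp only [hT, Finset.mem_filter, Finset.mem_product, Finset.mem_range,
        Nat.add_sub_cancel' hle]
      exact ⟨⟨⟨hq, by omega⟩, hp⟩, hmq, hqm⟩
  exact (Finset.card_le_card hsub).trans ((Finset.card_union_le _ _).trans
    (add_le_add Finset.card_image_le Finset.card_image_le))

theorem sum_windowCount_sq_le {P : Finset ℕ} {k N : ℕ} (hP : ∀ p ∈ P, k < p ∧ p ≤ N) :
    ∑ m ∈ Finset.Icc 1 N, windowCount P k m ^ 2 ≤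
      2 * (k * ∑ h ∈ Finset.range k, (P.filter fun p => p + h ∈ P).card) := by
  set D := (P ×ˢ Finset.range k).filter fun x => x.1 + x.2 ∈ P with hD
  have hDcard : D.card = ∑ h ∈ Finset.range k, (P.filter fun p => p + h ∈ P).card := by
    simp only [hD, Finset.card_filter]
    rw [Finset.sum_product_right]
  have h := Finset.sum_card_bipartiteAbove_eq_sum_card_bipartiteBelow
    (s := Finset.Icc 1 N) (t := D) (fun m x => m < x.1 ∧ x.1 ≤ m + k)
  simp only [Finset.bipartiteAbove, Finset.bipartiteBelow] at h
  have h' : ∀ x ∈ D,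
      ((Finset.Icc 1 N).filter fun m => m < x.1 ∧ x.1 ≤ m + k).card = k := fun x hx => by
    have hx' : x.1 ∈ P := (Finset.mem_product.1 (Finset.mem_filter.1 hx).1).1
    exact card_starts_eq (hP _ hx').1 (hP _ hx').2
  calc _ ≤ ∑ m ∈ Finset.Icc 1 N, 2 * (D.filter fun x => m < x.1 ∧ x.1 ≤ m + k).card :=
        Finset.sum_le_sum fun m _ => windowCount_sq_le P k m
    _ = 2 * (k * D.card) := by
        rw [← Finset.mul_sum, h, Finset.sum_congr rfl h', Finset.sum_const, smul_eq_mul, mul_comm k]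
    _ = _ := by rw [hDcard]

/-- The Cauchy–Schwarz inequality bounds from below the number of windows that meet `P`. -/
theorem card_sq_mul_le {P : Finset ℕ} {k N : ℕ} (hk : 0 < k) (hP : ∀ p ∈ P, k < p ∧ p ≤ N) :
    P.card ^ 2 * k ≤ ((Finset.Icc 1 N).filter fun m => ∃ p ∈ P, m < p ∧ p ≤ m + k).card *
      (2 * ∑ h ∈ Finset.range k, (P.filter fun p => p + h ∈ P).card) := by
  set B := (Finset.Icc 1 N).filter fun m => ∃ p ∈ P, m < p ∧ p ≤ m + k with hB
  have hsub : B ⊆ Finset.Icc 1 N := Finset.filter_subset _ _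
  have hsum : ∑ m ∈ B, windowCount P k m = P.card * k := by
    rw [← sum_windowCount hP]
    refine Finset.sum_subset hsub fun m hm hmB => ?_
    rw [windowCount, Finset.card_eq_zero, Finset.filter_eq_empty_iff]
    intro p hp hmp
    exact hmB (Finset.mem_filter.2 ⟨hm, p, hp, hmp⟩)
  have hcs : (P.card * k) ^ 2 ≤ B.card * ∑ m ∈ B, windowCount P k m ^ 2 := by
    rw [← hsum]
    exact sq_sum_le_card_mul_sum_sq
  have h2 : ∑ m ∈ B, windowCount P k m ^ 2 ≤
      2 * (k * ∑ h ∈ Finset.range k, (P.filter fun p => p + h ∈ P).card) :=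
    (Finset.sum_le_sum_of_subset hsub).trans (sum_windowCount_sq_le hP)
  refine le_of_mul_le_mul_left (a := k) ?_ hk
  calc k * (P.card ^ 2 * k) = (P.card * k) ^ 2 := by ring
    _ ≤ _ := hcs.trans (Nat.mul_le_mul_left _ h2)
    _ = _ := by ring

/-! ### Conclusion -/

/-- The primes in `(k, N]`. -/
def primesIn (k N : ℕ) : Finset ℕ := (Finset.Ioc k N).filter Nat.Prime

theorem primeCounting_le_card_primesIn_add (k N : ℕ) :
    Nat.primeCounting N ≤ (primesIn k N).card + k := by
  rw [← Nat.primesLE_card_eq_primeCounting]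
  calc (Nat.primesLE N).card ≤ (primesIn k N ∪ Finset.Ioc 0 k).card := by
        refine Finset.card_le_card fun p hp => ?_
        rw [Nat.mem_primesLE] at hp
        simp only [primesIn, Finset.mem_union, Finset.mem_filter, Finset.mem_Ioc]
        have := hp.2.pos
        by_cases h : p ≤ k
        · exact Or.inr ⟨this, h⟩
        · exact Or.inl ⟨⟨by omega, hp.1⟩, hp.2⟩
    _ ≤ _ := (Finset.card_union_le _ _).trans (by simp)

theorem sum_card_primesIn_pairs_le {X : ℝ} (hX : 2 ≤ X) (k : ℕ) :
    ∑ h ∈ Finset.range k,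
        (((primesIn k ⌊X⌋₊).filter fun p => p + h ∈ primesIn k ⌊X⌋₊).card : ℝ) ≤
      (primesIn k ⌊X⌋₊).card + 36912 * (k * (X / Real.log X ^ 2)) := by
  set P := primesIn k ⌊X⌋₊ with hP
  have hN : ((⌊X⌋₊ + 1 : ℕ) : ℝ) ≤ 2 * X := by
    have := Nat.floor_le (show 0 ≤ X by linarith)
    push_cast
    linarith
  have hle : ∀ h, (P.filter fun p => p + h ∈ P).card ≤ primePairCount h (⌊X⌋₊ + 1) := by
    intro h
    refine Finset.card_le_card fun p hp => ?_
    simp only [hP, primesIn, Finset.mem_filter, Finset.mem_Ioc, Finset.mem_range] at hp ⊢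
    exact ⟨by omega, hp.1.2, hp.2.2⟩
  calc _ ≤ ∑ h ∈ insert 0 (Finset.Icc 1 k), ((P.filter fun p => p + h ∈ P).card : ℝ) := by
        refine Finset.sum_le_sum_of_subset_of_nonneg (fun h hh => ?_) fun _ _ _ => by positivity
        rw [Finset.mem_range] at hh
        rw [Finset.mem_insert, Finset.mem_Icc]
        omega
    _ = (P.filter fun p => p + 0 ∈ P).card +
          ∑ h ∈ Finset.Icc 1 k, ((P.filter fun p => p + h ∈ P).card : ℝ) := by
        rw [Finset.sum_insert (by simp)]
    _ ≤ _ := by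
        refine add_le_add (by exact_mod_cast Finset.card_filter_le _ _) ?_
        exact (Finset.sum_le_sum fun h _ => by exact_mod_cast hle h).trans
          (sum_primePairCount_le hX hN k)

theorem eventually_div_log_le_card_primesIn {lam : ℝ} (hlam : 0 < lam) :
    ∀ᶠ X : ℝ in Filter.atTop,
      X / (4 * Real.log X) ≤ (primesIn ⌊lam * Real.log X⌋₊ ⌊X⌋₊).card := by
  have ho := (Real.isLittleO_pow_log_id_atTop (n := 2)).bound
    (c := 1 / (16 * (1 + lam))) (by positivity)
  filter_upwards [ho, Filter.eventually_ge_atTop (4 : ℝ),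
    Real.tendsto_log_atTop.eventually_ge_atTop 2] with X hX hX4 hL
  have hX0 : 0 < X := by linarith
  rw [Real.norm_of_nonneg (by positivity), id, Real.norm_of_nonneg hX0.le] at hX
  set L := Real.log X with hLdef
  have hL2 : (1 + lam) * L ^ 2 ≤ X / 16 := by
    calc (1 + lam) * L ^ 2 ≤ (1 + lam) * (1 / (16 * (1 + lam)) * X) := by gcongr
      _ = X / 16 := by field_simp
  have hpi := Chebyshev.pi_ge' (x := X) (by linarith)
  have hlog : Real.log (X + 2) ≤ 2 * L := by
    calc Real.log (X + 2) ≤ Real.log (X ^ 2) := Real.log_le_log (by linarith) (by nlinarith)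
      _ = 2 * L := by rw [Real.log_pow, hLdef]; norm_num
  have hk : (⌊lam * L⌋₊ : ℝ) ≤ lam * L := Nat.floor_le (by positivity)
  have hcard : (Nat.primeCounting ⌊X⌋₊ : ℝ) ≤
      (primesIn ⌊lam * L⌋₊ ⌊X⌋₊).card + ⌊lam * L⌋₊ := by
    exact_mod_cast primeCounting_le_card_primesIn_add _ _
  have hlog2 : (1 / 2 : ℝ) ≤ Real.log 2 := by linarith [Real.log_two_gt_d9]
  have key : X / (4 * L) + lam * L ≤ ((X - 1) * Real.log 2 - Real.log (X + 2)) / L := by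
    rw [le_div_iff₀ (by linarith)]
    have e : (X / (4 * L) + lam * L) * L = X / 4 + lam * L ^ 2 := by
      field_simp
    have h3 : (X - 1) * (1 / 2) ≤ (X - 1) * Real.log 2 := by gcongr; linarith
    have h4 : 2 * L ≤ L ^ 2 := by nlinarith
    rw [e]
    linarith
  linarith

theorem card_windows_le_ncard_primeIntervalStarts {X K : ℝ} (hX : 0 ≤ X) (hK : 0 ≤ K) :
    ((Finset.Icc 1 ⌊X⌋₊).filter fun m => ∃ p ∈ primesIn ⌊K⌋₊ ⌊X⌋₊, m < p ∧ p ≤ m + ⌊K⌋₊).card ≤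
      (primeIntervalStarts X K).ncard := by
  rw [← Set.ncard_coe_finset]
  refine Set.ncard_le_ncard ?_ (primeIntervalStarts_finite X K)
  intro m hm
  rw [Finset.mem_coe, Finset.mem_filter, Finset.mem_Icc] at hm
  obtain ⟨⟨hm1, hmX⟩, p, hp, hmp, hpm⟩ := hm
  refine ⟨hm1, (Nat.le_floor_iff hX).1 hmX, p, (Finset.mem_filter.1 hp).2, ?_, ?_⟩
  · exact_mod_cast hmp
  · have h1 : (p : ℝ) ≤ m + ⌊K⌋₊ := by exact_mod_cast hpm
    linarith [Nat.floor_le hK]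

theorem mainTheorem7 (lam : ℝ) (hlam : 0 < lam) :
    ∃ c : ℝ, 0 < c ∧ ∃ X₀ : ℝ, ∀ X : ℝ, X₀ ≤ X →
      c * X ≤ ((primeIntervalStarts X (lam * Real.log X)).ncard : ℝ) := by
  refine ⟨lam / (16 * (1 + 147648 * lam)), by positivity, ?_⟩
  rw [← Filter.eventually_atTop]
  filter_upwards [eventually_div_log_le_card_primesIn hlam, Filter.eventually_ge_atTop (2 : ℝ),
    Real.tendsto_log_atTop.eventually_ge_atTop (2 / lam)] with X hcard hX hLlam
  have hL : 0 < Real.log X := Real.log_pos (by linarith)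
  refine le_trans ?_ (Nat.cast_le.2 (card_windows_le_ncard_primeIntervalStarts
    (X := X) (K := lam * Real.log X) (by linarith) (by positivity)))
  have hpairs := sum_card_primesIn_pairs_le hX ⌊lam * Real.log X⌋₊
  have hK2 : 2 ≤ lam * Real.log X := by
    rw [div_le_iff₀ hlam] at hLlam
    linarith
  have hk : (⌊lam * Real.log X⌋₊ : ℝ) ≤ lam * Real.log X := Nat.floor_le (by linarith)
  have hk' : lam * Real.log X / 2 ≤ (⌊lam * Real.log X⌋₊ : ℝ) := by
    linarith [Nat.lt_floor_add_one (lam * Real.log X)]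
  have hk0 : 0 < ⌊lam * Real.log X⌋₊ := by
    have : (0 : ℝ) < ⌊lam * Real.log X⌋₊ := by linarith
    exact_mod_cast this
  set L := Real.log X with hLdef
  set k := ⌊lam * L⌋₊ with hkdef
  set P := primesIn k ⌊X⌋₊ with hPdef
  have hmoment := card_sq_mul_le (P := P) (N := ⌊X⌋₊) hk0
    fun p hp => Finset.mem_Ioc.1 (Finset.mem_filter.1 hp).1
  set B := (Finset.Icc 1 ⌊X⌋₊).filter fun m => ∃ p ∈ P, m < p ∧ p ≤ m + k with hB
  have hmoment' : (P.card : ℝ) ^ 2 * k ≤ B.card * (2 * ∑ h ∈ Finset.range k,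
      ((P.filter fun p => p + h ∈ P).card : ℝ)) := by exact_mod_cast hmoment
  have hPpos : (0 : ℝ) < P.card := lt_of_lt_of_le (by positivity) hcard
  have hXL : X / L ≤ 4 * P.card := by
    calc X / L = 4 * (X / (4 * L)) := by field_simp
      _ ≤ _ := by gcongr
  have hE : 36912 * (k * (X / L ^ 2)) ≤ 147648 * lam * P.card := by
    calc 36912 * (k * (X / L ^ 2)) ≤ 36912 * (lam * L * (X / L ^ 2)) := by gcongr
      _ = 36912 * lam * (X / L) := by field_simp
      _ ≤ 36912 * lam * (4 * P.card) := by gcongr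
      _ = _ := by ring
  have hsum : ∑ h ∈ Finset.range k, ((P.filter fun p => p + h ∈ P).card : ℝ) ≤
      (1 + 147648 * lam) * P.card := by linarith
  -- One factor `P.card` cancels, so no upper bound for the number of primes is needed.
  have hfin : (P.card : ℝ) * k ≤ B.card * (2 * (1 + 147648 * lam)) := by
    refine le_of_mul_le_mul_left ?_ hPpos
    calc (P.card : ℝ) * (P.card * k) = (P.card : ℝ) ^ 2 * k := by ring
      _ ≤ B.card * (2 * ((1 + 147648 * lam) * P.card)) := hmoment'.trans (by gcongr)
      _ = _ := by ring
  rw [div_mul_eq_mul_div, div_le_iff₀ (by positivity)]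
  have hlow : lam * X / 8 ≤ P.card * k := by
    calc lam * X / 8 = X / (4 * L) * (lam * L / 2) := by field_simp; norm_num
      _ ≤ P.card * k := by gcongr
  linarith
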